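/- For a square complex matrix $X$ let $X^D$ denote its Drazin inverse, i.e. the unique matrix with $XX^D=X^DX$, $X^D=X^DXX^D$ and $X^k=X^{k+1}X^D$ for some $k\in\mathbb N$, and put $X^\pi=I-XX^D$. For square complex matrices $E,F$ of the same size define $A_i,B_i,C_i,D_i$ $(i\ge 1)$ by $$A_1=-F^DE,\quad B_1=(F^D)^2+F^DE^2,\quad C_1=F^D+FF^DE^2,\quad D_1=-F^DE-FF^DEF^D-FF^DE^3,$$ $$A_{i+1}=F^DA_i-F^DEC_i,\qquad B_{i+1}=F^DB_i-F^DED_i,$$ $$C_{i+1}=-FF^DEA_i+(F^D+FF^DE^2)C_i,\qquad D_{i+1}=-FF^DEB_i+(F^D+FF^DE^2)D_i,$$ put $T=E^\pi-\sum_{j=1}^\infty (E^D)^{2j}F^j$ and, for $i\ge1$, $$G_i=TF^iF^\pi E+E^\pi E^{2i}F^\pi EFF^D+\sum_{k=0}^{i-2}E^\pi E^{2k+2}F^{i-k-1}F^\pi E,$$ $$J_i=E^\pi E^{2i-1}F^\pi EFF^D-\sum_{j=0}^\infty (E^D)^{2j+1}F^{i+j}F^\pi E+\sum_{k=0}^{i-2}E^\pi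 E^{2k+1}F^{i-k-1}F^\pi E,$$ and let $$\Gamma=\sum_{i=0}^\infty (E^D)^{2i+1}F^iF^\pi+TF^\pi EF^D+\sum_{i=1}^\infty G_iF^DC_i+\sum_{i=1}^\infty J_iA_i,$$ $$\Delta=-F^D-E^DF^\pi EF^D-\sum_{i=1}^\infty (E^D)^{2i+1}F^iF^\pi EF^D+\sum_{i=0}^\infty (E^D)^{2i+2}F^iF^\pi-TF^\pi EF^DEF^D+\sum_{i=1}^\infty G_iF^DD_i+\sum_{i=1}^\infty J_iB_i,$$ $$\Lambda=FF^D+\sum_{i=1}^\infty F^iF^\pi EA_i,\qquad \Xi=-FF^DEF^D+\sum_{i=1}^\infty F^iF^\pi EB_i .$$ **Theorem.** Let $A\in\mathbb C^{m\times m}$, $B\in\mathbb C^{m\times n}$, $C\in\mathbb C^{n\times m}$, $D\in\mathbb C^{n\times n}$ and $M=\begin{pmatrix}A&B\\C&D\end{pmatrix}$. Suppose $ABC=0$, $CBC=0$, $ABD(CB)^\pi=0$ and $CBD(CB)^\pi=0$. Put $$E=\begin{pmatrix}A&0\\C&D\end{pmatrix},\quad F=\begin{pmatrix}0&AB\\0&CB\end{pmatrix},\quad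 K=\begin{pmatrix}E&F\\I&0\end{pmatrix},\quad L=\begin{pmatrix}0&0&0&0\\0&0&0&0\\0&0&0&B\\0&0&0&0\end{pmatrix},$$ and let $\Gamma,\Delta,\Lambda,\Xi$ be formed from $E$ and $F$ as above. Then all the infinite series above converge, $$K^D=\begin{pmatrix}A&0&I&0\\C&D&0&I\\I&0&0&0\\0&I&0&0\end{pmatrix}\begin{pmatrix}\Gamma&\Delta\\\Lambda&\Xi\end{pmatrix}^2\begin{pmatrix}I&0&0&0\\0&I&0&0\\0&0&0&AB\\0&0&0&CB\end{pmatrix},$$ and $$M^D=\begin{pmatrix}I&0&0&B\\0&I&0&0\end{pmatrix}\left[K^D+L(K^D)^2\right]^2\begin{pmatrix}A&0\\C&D\\I&0\\0&I\end{pmatrix}.$$ -/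

import Mathlib

namespace BlockDrazin

open Matrix

/-- `X` is a Drazin inverse of the square complex matrix `A`. -/
structure IsDrazinInverse {ι : Type*} [Fintype ι] [DecidableEq ι] (A X : Matrix ι ι ℂ) : Prop where
  comm : A * X = X * A
  outer : X = X * A * X
  pow : ∃ m : ℕ, A ^ m = A ^ (m + 1) * X

/-- Every square complex matrix has a Drazin inverse. -/
theorem exists_isDrazinInverse {ι : Type*} [Fintype ι] [DecidableEq ι] (A : Matrix ι ι ℂ) :
    ∃ X, IsDrazinInverse A X := by
  obtain ⟨m, Y, hc, hY⟩ : ∃ (m : ℕ) (Y : Matrix ι ι ℂ), Commute A Y ∧ A ^ m = A ^ (m + 1) * Y := by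
    have hne : minpoly ℂ A ≠ 0 := minpoly.ne_zero (Algebra.IsIntegral.isIntegral A)
    obtain ⟨q, hq, hnd⟩ := Polynomial.exists_eq_pow_rootMultiplicity_mul_and_not_dvd
      (minpoly ℂ A) hne 0
    rw [map_zero, sub_zero] at hq hnd
    set k := (minpoly ℂ A).rootMultiplicity 0
    have hcop : IsCoprime (Polynomial.X : Polynomial ℂ) q :=
      (Polynomial.irreducible_X.coprime_iff_not_dvd).2 hnd
    obtain ⟨u, v, huv⟩ := hcop
    refine ⟨k, Polynomial.aeval A u, ?_, ?_⟩
    · have h : Polynomial.aeval A (Polynomial.X * u) = Polynomial.aeval A (u * Polynomial.X) := by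
        rw [mul_comm]
      simpa [Commute, SemiconjBy] using h
    · have h0 := minpoly.aeval ℂ A
      rw [hq] at h0
      have h1 : (Polynomial.X : Polynomial ℂ) ^ k
          = Polynomial.X ^ (k + 1) * u + (Polynomial.X ^ k * q) * v := by
        linear_combination (-(Polynomial.X : Polynomial ℂ) ^ k) * huv
      have h2 := congrArg (Polynomial.aeval A) h1
      rw [map_add, map_mul _ (Polynomial.X ^ k * q) v, h0] at h2
      simpa using h2
  have key : ∀ j : ℕ, A ^ m = A ^ (m + j) * Y ^ j := by
    intro j
    induction j with
    | zero => simp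
    | succ j ih =>
      calc A ^ m = A ^ (m + j) * Y ^ j := ih
        _ = A ^ j * A ^ m * Y ^ j := by rw [← pow_add, add_comm j m]
        _ = A ^ j * (A ^ (m + 1) * Y) * Y ^ j := by rw [← hY]
        _ = A ^ (m + (j + 1)) * Y ^ (j + 1) := by
          rw [pow_succ' Y j, ← mul_assoc, ← pow_add, mul_assoc]
          congr 2; ring
  have hpp : ∀ a b : ℕ, A ^ a * Y ^ b = Y ^ b * A ^ a := fun a b => (hc.pow_pow a b).eq
  refine ⟨A ^ m * Y ^ (m + 1), ?_, ?_, m, ?_⟩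
  · rw [mul_assoc, ← (hc.pow_right (m + 1)).eq, ← mul_assoc, ← mul_assoc,
      ← pow_succ, ← pow_succ']
  · have e : A ^ m * Y ^ (m + 1) * A * (A ^ m * Y ^ (m + 1))
        = A ^ (m + (m + 1)) * Y ^ (m + 1) * Y ^ (m + 1) := by
      calc A ^ m * Y ^ (m + 1) * A * (A ^ m * Y ^ (m + 1))
          = A ^ m * (Y ^ (m + 1) * A ^ (m + 1)) * Y ^ (m + 1) := by
            rw [pow_succ' A m]; simp only [mul_assoc]
        _ = _ := by rw [← hpp, ← mul_assoc, ← pow_add]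
    rw [e, ← key]
  · rw [← mul_assoc, ← pow_add, add_comm (m + 1) m]
    exact key (m + 1)

/-- The Drazin inverse is unique. -/
theorem IsDrazinInverse.unique {ι : Type*} [Fintype ι] [DecidableEq ι] {A X Y : Matrix ι ι ℂ}
    (hX : IsDrazinInverse A X) (hY : IsDrazinInverse A Y) : X = Y := by
  have up : ∀ {Z : Matrix ι ι ℂ}, IsDrazinInverse A Z →
      ∃ m : ℕ, ∀ n, m ≤ n → A ^ n = A ^ (n + 1) * Z := by
    intro Z hZ
    obtain ⟨m, hm⟩ := hZ.pow
    refine ⟨m, fun n hn => ?_⟩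
    obtain ⟨d, rfl⟩ := Nat.exists_eq_add_of_le hn
    calc A ^ (m + d) = A ^ d * A ^ m := by rw [← pow_add, add_comm]
      _ = A ^ d * (A ^ (m + 1) * Z) := by rw [← hm]
      _ = _ := by rw [← mul_assoc, ← pow_add]; congr 2; ring
  have down : ∀ {Z : Matrix ι ι ℂ}, IsDrazinInverse A Z → ∀ n : ℕ,
      Z = A ^ n * Z ^ (n + 1) ∧ Z = Z ^ (n + 1) * A ^ n := by
    intro Z hZ n
    have hc : Commute A Z := hZ.comm
    have h1 : Z = Z ^ (n + 1) * A ^ n := by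
      induction n with
      | zero => simp
      | succ n ih =>
        calc Z = Z ^ (n + 1) * A ^ n := ih
          _ = Z ^ n * (Z * A * Z) * A ^ n := by rw [← hZ.outer, ← pow_succ]
          _ = Z ^ n * (Z * (Z * A)) * A ^ n := by rw [mul_assoc Z A Z, hc.eq]
          _ = Z ^ (n + 1 + 1) * A ^ (n + 1) := by
            rw [pow_succ' A n, pow_succ Z (n + 1), pow_succ Z n]; simp only [mul_assoc]
    exact ⟨by rw [(hc.pow_pow n (n + 1)).eq]; exact h1, h1⟩
  obtain ⟨a, ha⟩ := up hX
  obtain ⟨b, hb⟩ := up hY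
  set n := max a b
  have hXn := ha n (le_max_left _ _)
  have hYn := hb n (le_max_right _ _)
  have hcX : Commute A X := hX.comm
  have e1 : X = X * A * Y := by
    calc X = X ^ (n + 1) * A ^ n := (down hX n).2
      _ = X ^ (n + 1) * (A ^ (n + 1) * Y) := by rw [← hYn]
      _ = X ^ (n + 1) * A ^ n * A * Y := by rw [pow_succ A n]; simp only [mul_assoc]
      _ = X * A * Y := by rw [← (down hX n).2]
  have e2 : Y = X * A * Y := by
    calc Y = A ^ n * Y ^ (n + 1) := (down hY n).1
      _ = A ^ (n + 1) * X * Y ^ (n + 1) := by rw [← hXn]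
      _ = X * A * (A ^ n * Y ^ (n + 1)) := by
        rw [(hcX.pow_left (n + 1)).eq, pow_succ' A n]; simp only [mul_assoc]
      _ = X * A * Y := by rw [← (down hY n).1]
  rw [e1, ← e2]

/-- The Drazin inverse of a square complex matrix. -/
noncomputable def drazin {ι : Type*} [Fintype ι] [DecidableEq ι] (A : Matrix ι ι ℂ) :
    Matrix ι ι ℂ :=
  Classical.choose (exists_isDrazinInverse A)

theorem drazin_spec {ι : Type*} [Fintype ι] [DecidableEq ι] (A : Matrix ι ι ℂ) :
    IsDrazinInverse A (drazin A) :=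
  Classical.choose_spec (exists_isDrazinInverse A)

theorem drazin_eq_iff {ι : Type*} [Fintype ι] [DecidableEq ι] (A X : Matrix ι ι ℂ) :
    drazin A = X ↔ IsDrazinInverse A X :=
  ⟨fun h => h ▸ drazin_spec A, fun h => (drazin_spec A).unique h⟩

/-- The Drazin inverse `Aᴰ`. -/
postfix:max "ᴰ" => drazin

/-- The eigenprojection at the eigenvalue `0`: `eigProj A = I - A Aᴰ`. -/
noncomputable def eigProj {ι : Type*} [Fintype ι] [DecidableEq ι] (A : Matrix ι ι ℂ) :
    Matrix ι ι ℂ :=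
  1 - A * Aᴰ

/-- The eigenprojection, written `Aᴾ` for "A to the power pi". -/
postfix:max "ᴾ" => eigProj

/-- A quadruple of coefficient matrices `(A_i, B_i, C_i, D_i)`. -/
structure Coeffs (ι : Type*) where
  A : Matrix ι ι ℂ
  B : Matrix ι ι ℂ
  C : Matrix ι ι ℂ
  D : Matrix ι ι ℂ

/-- `coeffs E F i` is the quadruple with index `i + 1`, that is `(A_{i+1}, ..., D_{i+1})`. -/
noncomputable def coeffs {ι : Type*} [Fintype ι] [DecidableEq ι] (E F : Matrix ι ι ℂ) :
    ℕ → Coeffs ι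
  | 0 =>
    { A := -(Fᴰ * E)
      B := Fᴰ ^ 2 + Fᴰ * E ^ 2
      C := Fᴰ + F * Fᴰ * E ^ 2
      D := -(Fᴰ * E) - F * Fᴰ * E * Fᴰ - F * Fᴰ * E ^ 3 }
  | i + 1 =>
    { A := Fᴰ * (coeffs E F i).A - Fᴰ * E * (coeffs E F i).C
      B := Fᴰ * (coeffs E F i).B - Fᴰ * E * (coeffs E F i).D
      C := -(F * Fᴰ * E * (coeffs E F i).A) + (Fᴰ + F * Fᴰ * E ^ 2) * (coeffs E F i).C
      D := -(F * Fᴰ * E * (coeffs E F i).B) + (Fᴰ + F * Fᴰ * E ^ 2) * (coeffs E F i).D }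

/-- `E^π - ∑_{j ≥ 1} (E^D)^{2j} F^j`. -/
noncomputable def tailProj {ι : Type*} [Fintype ι] [DecidableEq ι] (E F : Matrix ι ι ℂ) :
    Matrix ι ι ℂ :=
  Eᴾ - ∑' j : ℕ, Eᴰ ^ (2 * (j + 1)) * F ^ (j + 1)

/-- The bracket in front of `F^D C_i` and `F^D D_i`, used for `i ≥ 1`. The last sum runs over
`0 ≤ k ≤ i - 2`. -/
noncomputable def evenBracket {ι : Type*} [Fintype ι] [DecidableEq ι] (E F : Matrix ι ι ℂ)
    (i : ℕ) : Matrix ι ι ℂ :=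
  tailProj E F * F ^ i * Fᴾ * E + Eᴾ * E ^ (2 * i) * Fᴾ * E * F * Fᴰ
    + ∑ k ∈ Finset.range (i - 1), Eᴾ * E ^ (2 * k + 2) * F ^ (i - k - 1) * Fᴾ * E

/-- The bracket in front of `A_i` and `B_i`, used for `i ≥ 1`. The last sum runs over
`0 ≤ k ≤ i - 2`. -/
noncomputable def oddBracket {ι : Type*} [Fintype ι] [DecidableEq ι] (E F : Matrix ι ι ℂ)
    (i : ℕ) : Matrix ι ι ℂ :=
  Eᴾ * E ^ (2 * i - 1) * Fᴾ * E * F * Fᴰ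
    - ∑' j : ℕ, Eᴰ ^ (2 * j + 1) * F ^ (i + j) * Fᴾ * E
    + ∑ k ∈ Finset.range (i - 1), Eᴾ * E ^ (2 * k + 1) * F ^ (i - k - 1) * Fᴾ * E

/-- The block `Γ`. Sums over `i ≥ 1` are written with the index `i + 1`, `i : ℕ`. -/
noncomputable def blockΓ {ι : Type*} [Fintype ι] [DecidableEq ι] (E F : Matrix ι ι ℂ) :
    Matrix ι ι ℂ :=
  (∑' i : ℕ, Eᴰ ^ (2 * i + 1) * F ^ i * Fᴾ)
    + tailProj E F * Fᴾ * E * Fᴰ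
    + (∑' i : ℕ, evenBracket E F (i + 1) * Fᴰ * (coeffs E F i).C)
    + ∑' i : ℕ, oddBracket E F (i + 1) * (coeffs E F i).A

/-- The block `Δ`. -/
noncomputable def blockΔ {ι : Type*} [Fintype ι] [DecidableEq ι] (E F : Matrix ι ι ℂ) :
    Matrix ι ι ℂ :=
  -Fᴰ - Eᴰ * Fᴾ * E * Fᴰ
    - (∑' i : ℕ, Eᴰ ^ (2 * (i + 1) + 1) * F ^ (i + 1) * Fᴾ * E * Fᴰ)
    + (∑' i : ℕ, Eᴰ ^ (2 * i + 2) * F ^ i * Fᴾ)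
    - tailProj E F * Fᴾ * E * Fᴰ * E * Fᴰ
    + (∑' i : ℕ, evenBracket E F (i + 1) * Fᴰ * (coeffs E F i).D)
    + ∑' i : ℕ, oddBracket E F (i + 1) * (coeffs E F i).B

/-- The block `Λ`. -/
noncomputable def blockΛ {ι : Type*} [Fintype ι] [DecidableEq ι] (E F : Matrix ι ι ℂ) :
    Matrix ι ι ℂ :=
  F * Fᴰ + ∑' i : ℕ, F ^ (i + 1) * Fᴾ * E * (coeffs E F i).A

/-- The block `Ξ`. -/
noncomputable def blockΞ {ι : Type*} [Fintype ι] [DecidableEq ι] (E F : Matrix ι ι ℂ) :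
    Matrix ι ι ℂ :=
  -(F * Fᴰ * E * Fᴰ) + ∑' i : ℕ, F ^ (i + 1) * Fᴾ * E * (coeffs E F i).B

/-- All the infinite series that occur in the four blocks converge. -/
structure SeriesConverge {ι : Type*} [Fintype ι] [DecidableEq ι] (E F : Matrix ι ι ℂ) : Prop where
  tail : Summable fun j : ℕ => Eᴰ ^ (2 * (j + 1)) * F ^ (j + 1)
  odd : ∀ i : ℕ, Summable fun j : ℕ => Eᴰ ^ (2 * j + 1) * F ^ (i + 1 + j) * Fᴾ * E
  Γ₁ : Summable fun i : ℕ => Eᴰ ^ (2 * i + 1) * F ^ i * Fᴾ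
  Γ₂ : Summable fun i : ℕ => evenBracket E F (i + 1) * Fᴰ * (coeffs E F i).C
  Γ₃ : Summable fun i : ℕ => oddBracket E F (i + 1) * (coeffs E F i).A
  Δ₁ : Summable fun i : ℕ => Eᴰ ^ (2 * (i + 1) + 1) * F ^ (i + 1) * Fᴾ * E * Fᴰ
  Δ₂ : Summable fun i : ℕ => Eᴰ ^ (2 * i + 2) * F ^ i * Fᴾ
  Δ₃ : Summable fun i : ℕ => evenBracket E F (i + 1) * Fᴰ * (coeffs E F i).D
  Δ₄ : Summable fun i : ℕ => oddBracket E F (i + 1) * (coeffs E F i).B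
  Λ₁ : Summable fun i : ℕ => F ^ (i + 1) * Fᴾ * E * (coeffs E F i).A
  Ξ₁ : Summable fun i : ℕ => F ^ (i + 1) * Fᴾ * E * (coeffs E F i).B

end BlockDrazin

/-! From `C * B * C = 0` follows `(C * B) ^ 2 = 0`, so `(C * B)ᴾ = 1` and the last two hypotheses
become `A * B * D = 0` and `C * B * D = 0`. Hence `F * E = 0` and `F * F = 0`. Then `Fᴰ = 0` and `Fᴾ
= 1`, all coefficients vanish, and each series has at most two nonzero terms. The blocks collapse to
`Γ = Eᴰ + Eᴰ ^ 3 * F`, `Δ = Eᴰ ^ 2 + Eᴰ ^ 4 * F`, `Λ = Ξ = 0`, which form the Drazin inverse of `N =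
[E 1; F 0]` (`isDrazinInverse_fromBlocks`).

Cline's formula is used twice. With `P = [E 1; 1 0]` and `Q = diag(1, F)` one has `Q * P = N` and `P
* Q = K`, which gives `Kᴰ`. Moreover `M = U * V` and `V * U = K + L` with `K * L = 0` and `L * L =
0`, so `add_of_mul_eq_zero` gives `(K + L)ᴰ`, and Cline's formula carries it back to `M`. -/

namespace BlockDrazin

/-! ### Drazin inverses of products, sums and block matrices -/

section General

variable {ι κ : Type*} [Fintype ι] [DecidableEq ι] [Fintype κ] [DecidableEq κ]

theorem IsDrazinInverse.mul_mul_self {A X : Matrix ι ι ℂ} (h : IsDrazinInverse A X) :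
    A * (X * X) = X := by
  rw [← mul_assoc, h.comm, ← h.outer]

/-- Having the identity at every large exponent allows several factors `X` to be cancelled one after
another. -/
theorem IsDrazinInverse.pow_of_le {A X : Matrix ι ι ℂ} (h : IsDrazinInverse A X) :
    ∃ m : ℕ, ∀ j, m ≤ j → A ^ (j + 1) * X = A ^ j := by
  obtain ⟨m, hm⟩ := h.pow
  refine ⟨m, fun j hj => ?_⟩
  obtain ⟨d, rfl⟩ := Nat.exists_eq_add_of_le hj
  rw [show m + d + 1 = d + (m + 1) by ring, pow_add, mul_assoc, ← hm, ← pow_add, add_comm]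

theorem mul_pow_mul_comm (P : Matrix ι κ ℂ) (Q : Matrix κ ι ℂ) (j : ℕ) :
    (P * Q) ^ (j + 1) = P * (Q * P) ^ j * Q := by
  induction j with
  | zero => simp
  | succ j ih =>
    rw [pow_succ, ih, pow_succ (Q * P) j]
    simp only [Matrix.mul_assoc]

/-- Cline's formula. -/
theorem IsDrazinInverse.cline {P : Matrix ι κ ℂ} {Q : Matrix κ ι ℂ} {X : Matrix κ κ ℂ}
    (h : IsDrazinInverse (Q * P) X) : IsDrazinInverse (P * Q) (P * X ^ 2 * Q) := by
  have hX := h.mul_mul_self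
  have hX' : X * X * (Q * P) = X := by
    rw [mul_assoc, ← h.comm, ← mul_assoc, ← h.outer]
  have hl : P * Q * (P * X ^ 2 * Q) = P * X * Q := by
    calc P * Q * (P * X ^ 2 * Q) = P * (Q * P * (X * X)) * Q := by
          simp only [pow_two, Matrix.mul_assoc]
      _ = _ := by rw [hX]
  have hr : P * X ^ 2 * Q * (P * Q) = P * X * Q := by
    calc P * X ^ 2 * Q * (P * Q) = P * (X * X * (Q * P)) * Q := by
          simp only [pow_two, Matrix.mul_assoc]
      _ = _ := by rw [hX']
  refine ⟨hl.trans hr.symm, ?_, ?_⟩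
  · rw [hr]
    calc P * X ^ 2 * Q = P * (X * (Q * P * (X * X))) * Q := by rw [hX, pow_two]
      _ = P * X * Q * (P * X ^ 2 * Q) := by simp only [pow_two, Matrix.mul_assoc]
  · obtain ⟨m, hm⟩ := h.pow
    -- The index grows by one because `(P * Q) ^ (m + 1)` contains only `(Q * P) ^ m`.
    refine ⟨m + 1, ?_⟩
    calc (P * Q) ^ (m + 1) = P * ((Q * P) ^ (m + 1) * X) * Q := by rw [mul_pow_mul_comm, ← hm]
      _ = (P * Q) ^ (m + 1) * (P * X * Q) := by
        rw [mul_pow_mul_comm P Q, pow_succ (Q * P)]; simp only [Matrix.mul_assoc]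
      _ = (P * Q) ^ (m + 1 + 1) * (P * X ^ 2 * Q) := by
        rw [pow_succ _ (m + 1), mul_assoc, hl]

/-- Adding a square-zero matrix that is annihilated from the left. -/
theorem IsDrazinInverse.add_of_mul_eq_zero {K L X : Matrix ι ι ℂ} (h : IsDrazinInverse K X)
    (hKL : K * L = 0) (hLL : L * L = 0) : IsDrazinInverse (K + L) (X + L * X ^ 2) := by
  have hX := h.mul_mul_self
  have hXL : X * L = 0 := by
    calc X * L = X * X * (K * L) := by
          rw [← mul_assoc, mul_assoc X X K, ← h.comm, ← mul_assoc, ← h.outer]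
      _ = 0 := by rw [hKL, mul_zero]
  have hl : (K + L) * (X + L * X ^ 2) = K * X + L * X := by
    simp only [add_mul, mul_add, ← mul_assoc, hKL, hLL]; simp
  have hr : (X + L * X ^ 2) * (K + L) = K * X + L * X := by
    have e : L * (X * X) * K = L * X := by
      rw [mul_assoc, mul_assoc, ← h.comm, ← mul_assoc X, ← h.outer]
    have e' : L * (X * X) * L = 0 := by rw [mul_assoc, mul_assoc, hXL]; simp
    rw [add_mul, mul_add, mul_add, hXL, pow_two, e, e', h.comm]; simp
  -- Since `K * L = L * L = 0`, a factor `L` survives only in the leftmost position.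
  have hpow : ∀ j : ℕ, (K + L) ^ (j + 1) = K ^ (j + 1) + L * K ^ j := by
    intro j
    induction j with
    | zero => simp
    | succ j ih =>
      rw [pow_succ', ih, pow_succ' K (j + 1), pow_succ' K j]
      simp only [add_mul, mul_add, ← mul_assoc, hKL, hLL]; simp
  refine ⟨hl.trans hr.symm, ?_, ?_⟩
  · rw [hr]
    have e1 : K * X * X = X := by rw [mul_assoc, hX]
    have e2 : K * X * L = 0 := by rw [mul_assoc, hXL, mul_zero]
    have e3 : L * X * L = 0 := by rw [mul_assoc, hXL, mul_zero]
    simp only [add_mul, mul_add, ← mul_assoc, e1, e2, e3, pow_two]; simp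
  · obtain ⟨m, hm⟩ := h.pow_of_le
    -- The term `L * K ^ (m + 1)` keeps at least one `K` on the right, which kills the `L` of `L *
    -- X`, and leaves exponent `m` for `hm`.
    refine ⟨m + 2, ?_⟩
    have e : ∀ j : ℕ, K ^ (j + 1) * L = 0 := fun j => by rw [pow_succ, mul_assoc, hKL, mul_zero]
    have e' : ∀ j, m ≤ j → K ^ (j + 1) * (K * X + L * X) = K ^ (j + 1) := fun j hj => by
      rw [mul_add, ← mul_assoc, ← mul_assoc, e, ← pow_succ, hm _ (by omega), zero_mul, add_zero]
    rw [pow_succ _ (m + 2), mul_assoc, hl, hpow (m + 1), add_mul, e' _ (by omega), mul_assoc L,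
      e' _ le_rfl]

theorem drazin_eq_zero_of_mul_self {F : Matrix ι ι ℂ} (h : F * F = 0) : Fᴰ = 0 :=
  (drazin_eq_iff _ _).2 ⟨by simp, by simp, 2, by rw [pow_two, h]; simp⟩

/-- The Drazin inverse of `[E I; F 0]` when `F E = 0` and `F² = 0`. -/
theorem isDrazinInverse_fromBlocks {E F X : Matrix ι ι ℂ} (h : IsDrazinInverse E X)
    (hFE : F * E = 0) (hFF : F * F = 0) :
    IsDrazinInverse (Matrix.fromBlocks E 1 F 0)
      (Matrix.fromBlocks (X + X ^ 3 * F) (X ^ 2 + X ^ 4 * F) 0 0) := by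
  have hX := h.mul_mul_self
  have hFX : F * X = 0 := by rw [← hX, ← mul_assoc, hFE, zero_mul]
  have hEX2 : E * X ^ 2 = X := by rw [pow_two, hX]
  have hEX3 : E * X ^ 3 = X ^ 2 := by rw [pow_succ, ← mul_assoc, hEX2, pow_two]
  have hEX4 : E * X ^ 4 = X ^ 3 := by rw [pow_succ, ← mul_assoc, hEX3, ← pow_succ]
  have hF : ∀ j : ℕ, F * X ^ (j + 1) = 0 := fun j => by rw [pow_succ', ← mul_assoc, hFX, zero_mul]
  have hl : Matrix.fromBlocks E 1 F 0
      * Matrix.fromBlocks (X + X ^ 3 * F) (X ^ 2 + X ^ 4 * F) 0 0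
      = Matrix.fromBlocks (E * X + X ^ 2 * F) (X + X ^ 3 * F) 0 0 := by
    rw [Matrix.fromBlocks_multiply]
    simp only [mul_add, ← mul_assoc, hEX2, hEX3, hEX4, hFX, hF 1, hF 2, hF 3]
    simp
  have hr : Matrix.fromBlocks (X + X ^ 3 * F) (X ^ 2 + X ^ 4 * F) (0 : Matrix ι ι ℂ) 0
      * Matrix.fromBlocks E 1 F 0
      = Matrix.fromBlocks (E * X + X ^ 2 * F) (X + X ^ 3 * F) 0 0 := by
    rw [Matrix.fromBlocks_multiply]
    simp only [add_mul, mul_assoc, hFE, hFF, h.comm]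
    simp
  refine ⟨hl.trans hr.symm, ?_, ?_⟩
  · rw [hr, Matrix.fromBlocks_multiply]
    have e1 : E * X * X = X := by rw [mul_assoc, hX]
    have e2 : E * X * X ^ 2 = X ^ 2 := by rw [pow_two, ← mul_assoc, e1]
    have e3 : E * X * X ^ 3 = X ^ 3 := by rw [pow_succ, ← mul_assoc, e2]
    have e4 : E * X * X ^ 4 = X ^ 4 := by rw [pow_succ, ← mul_assoc, e3]
    simp only [mul_add, add_mul, ← mul_assoc, e1, e2, e3, e4, mul_assoc (X ^ 2) F, hFX,
      hF 1, hF 2, hF 3]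
    simp
  · obtain ⟨m, hm⟩ := h.pow_of_le
    -- The bottom rows of the first three powers are `[F 0]`, `[F * E F] = [0 F]` and `[F * F 0] =
    -- 0`, hence the offset 3.
    have hpow : ∀ j : ℕ, Matrix.fromBlocks E 1 F 0 ^ (j + 3)
        = Matrix.fromBlocks (E ^ (j + 3) + E ^ (j + 1) * F) (E ^ (j + 2) + E ^ j * F) 0 0 := by
      intro j
      induction j with
      | zero =>
        simp only [pow_succ, pow_zero, one_mul, zero_add, Matrix.fromBlocks_multiply, mul_one,
          mul_zero, add_zero, add_mul, hFE, hFF, mul_assoc]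
        simp
      | succ j ih =>
        rw [pow_succ, show j + 1 + 2 = j + 3 by ring, ih, Matrix.fromBlocks_multiply]
        simp only [add_mul, mul_assoc, hFE, hFF, ← pow_succ, mul_one, mul_zero, zero_mul, add_zero]
    -- The lowest power of `E` in the result is the `E ^ m` of the corner term `E ^ m * F`.
    refine ⟨m + 3, ?_⟩
    have a1 : ∀ j, m ≤ j → E ^ (j + 2) * X ^ 2 = E ^ j := fun j hj => by
      rw [pow_two, ← mul_assoc, hm _ (by omega), hm _ hj]
    have a2 : ∀ j, m ≤ j → E ^ (j + 3) * X ^ 3 = E ^ j := fun j hj => by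
      rw [pow_succ X, ← mul_assoc, a1 _ (by omega), hm _ hj]
    have a3 : ∀ j, m ≤ j → E ^ (j + 4) * X ^ 4 = E ^ j := fun j hj => by
      rw [pow_succ X, ← mul_assoc, a2 _ (by omega), hm _ hj]
    rw [show m + 3 + 1 = m + 1 + 3 by ring, hpow, hpow, Matrix.fromBlocks_multiply]
    simp only [add_mul, mul_add, mul_assoc _ F, ← mul_assoc F, hFX, hF 1, hF 2, hF 3,
      ← mul_assoc (E ^ _), zero_mul, mul_zero, add_zero, hm _ (show m ≤ m + 3 by omega),
      a1 _ (show m ≤ m + 2 by omega), a2 _ (show m ≤ m + 1 by omega), a3 _ le_rfl,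
      show m + 1 + 3 = m + 4 by ring]

theorem hasSum_of_eq_zero_add_two {M : Type*} [AddCommMonoid M] [TopologicalSpace M]
    {f : ℕ → M} (h : ∀ i, f (i + 2) = 0) : HasSum f (f 0 + f 1) := by
  have : HasSum f (∑ i ∈ Finset.range 2, f i) := hasSum_sum_of_ne_finset_zero fun b hb => by
    obtain ⟨d, rfl⟩ := Nat.exists_eq_add_of_le (not_lt.1 (mt Finset.mem_range.2 hb))
    rw [add_comm]; exact h d
  simpa [Finset.sum_range_succ] using this

end General

/-! ### Collapse of the series when `F * F = 0` -/

section SquareZero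

variable {ι : Type*} [Fintype ι] [DecidableEq ι] {E F : Matrix ι ι ℂ}

theorem eigProj_eq_one_of_mul_self (hFF : F * F = 0) : Fᴾ = 1 := by
  simp [eigProj, drazin_eq_zero_of_mul_self hFF]

/-- Every term of the initial coefficients contains `Fᴰ = 0`, and the recursion is linear and
homogeneous. -/
theorem coeffs_eq_zero_of_mul_self (hFF : F * F = 0) (i : ℕ) : coeffs E F i = ⟨0, 0, 0, 0⟩ := by
  induction i with
  | zero => simp [coeffs, drazin_eq_zero_of_mul_self hFF]
  | succ i ih => simp [coeffs, drazin_eq_zero_of_mul_self hFF, ih]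

theorem pow_add_two_of_mul_self (hFF : F * F = 0) (i : ℕ) : F ^ (i + 2) = 0 := by
  rw [pow_add, pow_two, hFF, mul_zero]

theorem pow_succ_mul_of_mul_eq_zero (hFE : F * E = 0) (i : ℕ) : F ^ (i + 1) * E = 0 := by
  rw [pow_succ, mul_assoc, hFE, mul_zero]

theorem seriesConverge_of_mul_eq_zero (hFE : F * E = 0) (hFF : F * F = 0) :
    SeriesConverge E F := by
  have hD := drazin_eq_zero_of_mul_self hFF
  have hP := eigProj_eq_one_of_mul_self hFF
  have hc := coeffs_eq_zero_of_mul_self (E := E) hFF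
  have hp := pow_add_two_of_mul_self hFF
  have hz : Summable fun _ : ℕ => (0 : Matrix ι ι ℂ) := summable_zero
  constructor
  · exact (hasSum_of_eq_zero_add_two fun i => by rw [add_right_comm, hp, mul_zero]).summable
  · intro i
    -- Here `F` has exponent at least 1 and meets `E` directly because `Fᴾ = 1`, so every term is
    -- zero.
    refine hz.congr fun j => ?_
    rw [hP, mul_one, mul_assoc, add_right_comm i 1 j, pow_succ_mul_of_mul_eq_zero hFE, mul_zero]
  · exact (hasSum_of_eq_zero_add_two fun i => by rw [hp, mul_zero, zero_mul]).summable
  · simp [hc]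
  · simp [hc]
  · simp [hD]
  · exact (hasSum_of_eq_zero_add_two fun i => by rw [hp, mul_zero, zero_mul]).summable
  · simp [hc]
  · simp [hc]
  · simp [hc]
  · simp [hc]

/-- Only the first series is free of `Fᴰ` and of the coefficients; its terms `i = 0, 1` remain. -/
theorem blockΓ_of_mul_self (hFF : F * F = 0) : blockΓ E F = Eᴰ + Eᴰ ^ 3 * F := by
  have hs : HasSum (fun i : ℕ => Eᴰ ^ (2 * i + 1) * F ^ i * Fᴾ) (Eᴰ + Eᴰ ^ 3 * F) := by
    simpa [eigProj_eq_one_of_mul_self hFF] using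
      hasSum_of_eq_zero_add_two (f := fun i : ℕ => Eᴰ ^ (2 * i + 1) * F ^ i * Fᴾ)
        fun i => by rw [pow_add_two_of_mul_self hFF, mul_zero, zero_mul]
  simp [blockΓ, hs.tsum_eq, coeffs_eq_zero_of_mul_self hFF, drazin_eq_zero_of_mul_self hFF]

theorem blockΔ_of_mul_self (hFF : F * F = 0) : blockΔ E F = Eᴰ ^ 2 + Eᴰ ^ 4 * F := by
  have hs : HasSum (fun i : ℕ => Eᴰ ^ (2 * i + 2) * F ^ i * Fᴾ) (Eᴰ ^ 2 + Eᴰ ^ 4 * F) := by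
    simpa [eigProj_eq_one_of_mul_self hFF] using
      hasSum_of_eq_zero_add_two (f := fun i : ℕ => Eᴰ ^ (2 * i + 2) * F ^ i * Fᴾ)
        fun i => by rw [pow_add_two_of_mul_self hFF, mul_zero, zero_mul]
  simp [blockΔ, hs.tsum_eq, coeffs_eq_zero_of_mul_self hFF, drazin_eq_zero_of_mul_self hFF]

theorem blockΛ_of_mul_self (hFF : F * F = 0) : blockΛ E F = 0 := by
  simp [blockΛ, coeffs_eq_zero_of_mul_self hFF, drazin_eq_zero_of_mul_self hFF]

theorem blockΞ_of_mul_self (hFF : F * F = 0) : blockΞ E F = 0 := by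
  simp [blockΞ, coeffs_eq_zero_of_mul_self hFF, drazin_eq_zero_of_mul_self hFF]

end SquareZero

end BlockDrazin

/-! ### The formulas for `Kᴰ` and `Mᴰ` -/

theorem theorem3p4 (m n : ℕ)
    (A : Matrix (Fin m) (Fin m) ℂ) (B : Matrix (Fin m) (Fin n) ℂ)
    (C : Matrix (Fin n) (Fin m) ℂ) (D : Matrix (Fin n) (Fin n) ℂ)
    (hABC : A * B * C = 0) (hCBC : C * B * C = 0)
    (hABD : A * B * D * BlockDrazin.eigProj (C * B) = 0)
    (hCBD : C * B * D * BlockDrazin.eigProj (C * B) = 0)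
    (M E F : Matrix (Fin m ⊕ Fin n) (Fin m ⊕ Fin n) ℂ)
    (K L KD : Matrix ((Fin m ⊕ Fin n) ⊕ (Fin m ⊕ Fin n)) ((Fin m ⊕ Fin n) ⊕ (Fin m ⊕ Fin n)) ℂ)
    (U : Matrix (Fin m ⊕ Fin n) ((Fin m ⊕ Fin n) ⊕ (Fin m ⊕ Fin n)) ℂ)
    (V : Matrix ((Fin m ⊕ Fin n) ⊕ (Fin m ⊕ Fin n)) (Fin m ⊕ Fin n) ℂ)
    (hM : M = Matrix.fromBlocks A B C D)
    (hE : E = Matrix.fromBlocks A 0 C D)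
    (hF : F = Matrix.fromBlocks 0 (A * B) 0 (C * B))
    (hK : K = Matrix.fromBlocks E F 1 0)
    (hL : L = Matrix.fromBlocks 0 0 0 (Matrix.fromBlocks 0 B 0 0))
    (hKD : KD = Matrix.fromBlocks (Matrix.fromBlocks A 0 C D) 1 1 0
      * Matrix.fromBlocks (BlockDrazin.blockΓ E F) (BlockDrazin.blockΔ E F)
          (BlockDrazin.blockΛ E F) (BlockDrazin.blockΞ E F) ^ 2
      * Matrix.fromBlocks 1 0 0 (Matrix.fromBlocks 0 (A * B) 0 (C * B)))
    (hU : U = Matrix.fromCols 1 (Matrix.fromBlocks 0 B 0 0))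
    (hV : V = Matrix.fromRows (Matrix.fromBlocks A 0 C D) 1) :
    BlockDrazin.SeriesConverge E F ∧
    BlockDrazin.drazin K = KD ∧
    BlockDrazin.drazin M = U * (KD + L * KD ^ 2) ^ 2 * V := by
  have hCB : C * B * (C * B) = 0 := by rw [← Matrix.mul_assoc, hCBC, Matrix.zero_mul]
  have hAB : A * B * (C * B) = 0 := by rw [← Matrix.mul_assoc, hABC, Matrix.zero_mul]
  rw [BlockDrazin.eigProj_eq_one_of_mul_self hCB, Matrix.mul_one] at hABD hCBD
  have hFE : F * E = 0 := by
    rw [hF, hE, Matrix.fromBlocks_multiply]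
    simp [hABC, hCBC, hABD, hCBD]
  have hFF : F * F = 0 := by
    rw [hF, Matrix.fromBlocks_multiply]
    simp [hAB, hCB]
  rw [← hE, ← hF] at hKD
  rw [← hE] at hV
  have hN : BlockDrazin.IsDrazinInverse (Matrix.fromBlocks E 1 F 0)
      (Matrix.fromBlocks (BlockDrazin.blockΓ E F) (BlockDrazin.blockΔ E F)
        (BlockDrazin.blockΛ E F) (BlockDrazin.blockΞ E F)) := by
    rw [BlockDrazin.blockΓ_of_mul_self hFF, BlockDrazin.blockΔ_of_mul_self hFF,
      BlockDrazin.blockΛ_of_mul_self hFF, BlockDrazin.blockΞ_of_mul_self hFF]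
    exact BlockDrazin.isDrazinInverse_fromBlocks (BlockDrazin.drazin_spec E) hFE hFF
  have hKN : BlockDrazin.IsDrazinInverse K KD := by
    -- The two orders of this product are `N` and `K`, as Cline's formula requires.
    have hQP : Matrix.fromBlocks 1 0 0 F * Matrix.fromBlocks E 1 1 0
        = Matrix.fromBlocks E 1 F 0 := by
      simp [Matrix.fromBlocks_multiply]
    have hPQ : Matrix.fromBlocks E 1 1 0 * Matrix.fromBlocks 1 0 0 F = K := by
      simp [hK, Matrix.fromBlocks_multiply]
    rw [← hQP] at hN
    rw [hKD, ← hPQ]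
    exact hN.cline
  have hKL : K * L = 0 := by
    have hFB : F * Matrix.fromBlocks 0 B 0 0 = 0 := by
      simp [hF, Matrix.fromBlocks_multiply]
    simp [hK, hL, Matrix.fromBlocks_multiply, hFB]
  have hLL : L * L = 0 := by
    simp [hL, Matrix.fromBlocks_multiply]
  have hVU : V * U = K + L := by
    -- This identity is the origin of `F`: it is the upper right block of `V * U`.
    have hEB : E * Matrix.fromBlocks 0 B 0 0 = F := by
      simp [hE, hF, Matrix.fromBlocks_multiply]
    simp [hV, hU, hK, hL, Matrix.fromBlocks_add, hEB]
  have hUV : U * V = M := by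
    simp [hV, hU, hE, hM, Matrix.fromCols_mul_fromRows, Matrix.fromBlocks_add]
  refine ⟨BlockDrazin.seriesConverge_of_mul_eq_zero hFE hFF,
    (BlockDrazin.drazin_eq_iff _ _).2 hKN, (BlockDrazin.drazin_eq_iff _ _).2 ?_⟩
  have h := hKN.add_of_mul_eq_zero hKL hLL
  rw [← hVU] at h
  rw [← hUV]
  exact h.cline
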